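/- For $0<\theta<\pi/2$ let $S(\theta)=\{z\in\mathbb{C} : |\arg z|\le\theta \text{ or } z=0\}$ (with $-\pi<\arg z\le\pi$) and $\pm S(\theta)=\{z\in\mathbb{C} : z\in S(\theta)\text{ or }-z\in S(\theta)\}$. A sequence $\{\gamma_k\}_{k=0}^\infty$ of real numbers is called a multiplier sequence of the second kind if the linear operator on $\mathbb{R}[z]$ defined by $z^k\mapsto\gamma_k z^k$ $(k\ge 0)$ maps every real polynomial all of whose complex zeros are positive real numbers to a polynomial all of whose complex zeros are real. Throughout, the identically zero polynomial is regarded as having no zeros, so it is allowed as an image. **Theorem.** Let $T\colon\mathbb{C}[z]\to\mathbb{C}[z]$ be a linear operator with $T[z^k]=c\,\gamma_k z^k$ for all $k\ge 0$, where $c\in\mathbb{C}$, $c\neq 0$, and $\gamma_k\in\mathbb{R}$, and fix $\theta$ with $0<\theta<\pi/2$. Then $T$ sends every polynomial $p\in\mathbb{C}[z]$ with zeros only in $S(\theta)$ to a polynomial whose zeros all lie in $\pm S(\theta)$ if and only if $\{\gamma_k\}_{k=0}^{\infty}$ is a multiplier sequence of the second kind. -/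

import Mathlib

open Polynomial

/-- Every zero of `p` lies in `S`. The zero polynomial satisfies this by convention. -/
def ZerosIn (p : ℂ[X]) (S : Set ℂ) : Prop :=
  p ≠ 0 → ∀ z : ℂ, p.IsRoot z → z ∈ S

/-- The closed sector `S(θ) = {z : |arg z| ≤ θ or z = 0}`. -/
def sector (θ : ℝ) : Set ℂ :=
  {z | |Complex.arg z| ≤ θ ∨ z = 0}

/-- The double sector `±S(θ) = {z : z ∈ S(θ) or -z ∈ S(θ)}`. -/
def doubleSector (θ : ℝ) : Set ℂ :=
  {z | z ∈ sector θ ∨ -z ∈ sector θ}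

/-- The linear operator on real polynomials with `z ^ k ↦ γ k * z ^ k`. -/
noncomputable def diagonalOperator (γ : ℕ → ℝ) : ℝ[X] →ₗ[ℝ] ℝ[X] :=
  (Polynomial.basisMonomials ℝ).constr ℝ fun k => C (γ k) * X ^ k

theorem diagonalOperator_X_pow (γ : ℕ → ℝ) (k : ℕ) :
    diagonalOperator γ (X ^ k) = C (γ k) * X ^ k := by
  have h := (Polynomial.basisMonomials ℝ).constr_basis ℝ (fun k => C (γ k) * X ^ k : ℕ → ℝ[X]) k
  simpa [diagonalOperator, Polynomial.X_pow_eq_monomial] using h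

/-- `γ` is a multiplier sequence of the second kind: the operator `z ^ k ↦ γ k * z ^ k` maps real
polynomials with only positive real zeros to polynomials with only real zeros (or to the zero
polynomial). All complex zeros are considered. -/
def IsMultiplierSequenceSecondKind (γ : ℕ → ℝ) : Prop :=
  ∀ p : ℝ[X], ZerosIn (p.map (algebraMap ℝ ℂ)) {z | z.im = 0 ∧ 0 < z.re} →
    ZerosIn ((diagonalOperator γ p).map (algebraMap ℝ ℂ)) {z | z.im = 0}

/-!
The argument rests on one fact about linear functionals (`linearFunctional_prod_ne_zero`, a form of
the Grace–Walsh–Szegő theorem): if `L ((X - ζ) ^ n) ≠ 0` for every `ζ` in an open half-plane whose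
boundary passes through `0`, then `L` does not vanish on any product of `n` factors `X - ζⱼ` with
all `ζⱼ` in that half-plane. It follows by replacing the equal zeros one at a time, each replacement
being an instance of Laguerre's theorem on polar derivatives.

Suppose that `γ` is a multiplier sequence of the second kind and that `w ∉ ±S(θ)`. Then `S(θ) \ {0}`
lies in an open half-plane `H` bounded by the line `ℝ w`. Apply the fact above to the functional
`L r = (T r)(w)`: since `T` commutes with the substitutions `z ↦ u z`, the zeros of
`T ((X - ζ) ^ n)` lie on the line `ℝ ζ`, which for `ζ ∈ H` does not contain `w`, unless
`T ((X - ζ) ^ n)` vanishes identically; but then `T` annihilates all polynomials of degree at most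
`n`. So if the zeros of `q` lie in `S(θ) \ {0}` and `T q ≠ 0`, then `T q` does not vanish at `w`.
A zero of `p` at the origin is removed by passing to a shifted sequence,
`T (X ^ m * q) = X ^ m * T' q`. Shifting preserves the real-rootedness
of the images of `(X - 1) ^ n` by the Gauss–Lucas theorem, because it corresponds to differentiation:
`(T p)' = T' (p')`.

Conversely, let `p` have only positive zeros and let `w` be a nonreal zero of `T p`. For `|α| ≤ θ`
the polynomial `p (e ^ (-iα) z)` has its zeros in `S(θ)`, and its image vanishes at `e ^ (iα) w`;
a suitable `α` moves `w` out of `±S(θ)`.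
-/

/-! ### Linear functionals and half-planes -/

/-- Cauchy–Schwarz in the form that makes the disc `{u | y * |u|² ≤ -Im u}`, the image of the
half-plane `Im ≥ y` under inversion, stable under averaging. -/
theorem mul_normSq_sum_le_card_mul_neg_im {y : ℝ} (hy : 0 < y) (M : Multiset ℂ)
    (hM : ∀ u ∈ M, y * Complex.normSq u ≤ -u.im) :
    y * Complex.normSq M.sum ≤ M.card * (-M.sum.im) := by
  induction M using Multiset.induction with
  | empty => simp
  | cons u M ih =>
    have hu := hM u (Multiset.mem_cons_self u M)
    have hS := ih fun v hv => hM v (Multiset.mem_cons_of_mem hv)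
    rcases Nat.eq_zero_or_pos M.card with h0 | hpos
    · rw [Multiset.card_eq_zero] at h0
      subst h0
      simpa using hu
    · have hm : (0 : ℝ) < M.card := by exact_mod_cast hpos
      simp only [Multiset.sum_cons, Multiset.card_cons, Complex.normSq_apply, Complex.add_re,
        Complex.add_im, Nat.cast_add, Nat.cast_one] at *
      set m : ℝ := (M.card : ℝ)
      set S := M.sum
      refine le_of_mul_le_mul_left ?_ hm
      have key : 0 ≤ y * ((S.re - m * u.re) ^ 2 + (S.im - m * u.im) ^ 2) := by positivity
      have h1 := mul_le_mul_of_nonneg_left hS (by positivity : (0 : ℝ) ≤ m + 1)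
      have h2 := mul_le_mul_of_nonneg_left hu (by positivity : (0 : ℝ) ≤ m * (m + 1))
      linarith

/-- Laguerre's theorem, stated for a linear functional: the polynomial `ζ ↦ L ((X - ζ) ^ (n + 1))`
has no zeros in the half-plane `Im (a ζ) > 0`, and up to a factor its polar derivative with respect
to `ζ₁` is `z ↦ L ((X - ζ₁) * (X - z) ^ n)`. -/
theorem linearFunctional_polar_ne_zero {a : ℂ} {n : ℕ} (L : ℂ[X] →ₗ[ℂ] ℂ)
    (hL : ∀ ζ : ℂ, 0 < (a * ζ).im → L ((X - C ζ) ^ (n + 1)) ≠ 0)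
    {ζ₁ z : ℂ} (hζ₁ : 0 < (a * ζ₁).im) (hz : 0 < (a * z).im) :
    L ((X - C ζ₁) * (X - C z) ^ n) ≠ 0 := by
  intro h0
  have ha : a ≠ 0 := by rintro rfl; simp at hz
  -- `P t = L ((X - (z - t)) ^ (n + 1))`, the expansion of the functional around `z`.
  set P : ℂ[X] := ∑ k ∈ Finset.range (n + 2),
    C (L ((X - C z) ^ k) * ((n + 1).choose k : ℂ)) * X ^ (n + 1 - k) with hP
  have hPeval : ∀ t : ℂ, P.eval t = L ((X - C (z - t)) ^ (n + 1)) := by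
    intro t
    have e : (X - C (z - t) : ℂ[X]) = (X - C z) + C t := by rw [C_sub]; ring
    rw [e, add_pow, map_sum, hP, eval_finsetSum]
    refine Finset.sum_congr rfl fun k _ => ?_
    have e2 : (X - C z) ^ k * C t ^ (n + 1 - k) * ((n + 1).choose k : ℂ[X])
        = (t ^ (n + 1 - k) * ((n + 1).choose k : ℂ)) • (X - C z) ^ k := by
      rw [smul_eq_C_mul, C_mul, C_pow, C_eq_natCast]; ring
    rw [e2, map_smul]
    simp only [eval_mul, eval_C, eval_pow, eval_X, smul_eq_mul]
    ring
  have hcoeff : ∀ j ≤ n + 1, P.coeff j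
      = L ((X - C z) ^ (n + 1 - j)) * ((n + 1).choose (n + 1 - j) : ℂ) := by
    intro j hj
    rw [hP, finsetSum_coeff, Finset.sum_eq_single (n + 1 - j)]
    · rw [coeff_C_mul_X_pow, if_pos (by omega)]
    · intro k hk hne
      rw [Finset.mem_range] at hk
      rw [coeff_C_mul_X_pow, if_neg (by omega)]
    · intro h
      exact absurd (Finset.mem_range.2 (by omega)) h
  have hb0 : P.eval 0 = L ((X - C z) ^ (n + 1)) := by rw [hPeval]; simp
  have hP0 : P.eval 0 ≠ 0 := by rw [hb0]; exact hL z hz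
  have hb1 : P.derivative.eval 0 = (n + 1) * L ((X - C z) ^ n) := by
    rw [← coeff_zero_eq_eval_zero, coeff_derivative, hcoeff 1 (by omega)]
    simp
    ring
  have hdeg : P.natDegree ≤ n + 1 := by
    refine natDegree_sum_le_of_forall_le _ _ fun k _ => ?_
    exact (natDegree_C_mul_X_pow_le _ _).trans (by omega)
  have hPne : P ≠ 0 := by rintro h; simp [h] at hP0
  -- The zeros of `P` are at the points `t` with `Im (a t) ≥ Im (a z)`.
  have hroots : ∀ t ∈ P.roots, (a * z).im ≤ (a * t).im := by
    intro t ht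
    rw [mem_roots hPne, IsRoot.def, hPeval] at ht
    by_contra! hlt
    refine hL (z - t) ?_ ht
    rw [mul_sub, Complex.sub_im]
    linarith
  set V : ℂ := (P.roots.map fun t => 1 / (a * t)).sum with hV
  have hlog : P.derivative.eval 0 = -(a * V) * P.eval 0 := by
    rw [← div_eq_iff hP0, (IsAlgClosed.splits P).eval_derivative_div_eval_of_ne_zero hP0, hV,
      ← Multiset.sum_map_mul_left, ← Multiset.sum_map_neg]
    refine congrArg Multiset.sum (Multiset.map_congr rfl fun t ht => ?_)
    have ht0 : t ≠ 0 := by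
      rintro rfl
      have := hroots 0 ht
      simp at this
      simp at hz
      linarith
    field_simp
    simp
  have hVle := mul_normSq_sum_le_card_mul_neg_im hz (P.roots.map fun t => 1 / (a * t)) (by
    intro u hu
    obtain ⟨t, ht, rfl⟩ := Multiset.mem_map.1 hu
    have h1 := hroots t ht
    have hpos : 0 < Complex.normSq (a * t) := by
      rw [Complex.normSq_pos]
      intro h
      rw [h] at h1
      simp only [Complex.zero_im] at h1
      linarith
    rw [one_div, Complex.normSq_inv, Complex.inv_im, ← div_eq_mul_inv, neg_div, neg_neg]
    gcongr)
  rw [← hV, Multiset.card_map] at hVle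
  have hcard : (P.roots.card : ℝ) ≤ n + 1 := by
    exact_mod_cast (card_roots' P).trans hdeg
  -- The polar derivative vanishes at `z`, so `(a z - a ζ₁) V = n + 1`.
  have hdV : (a * z - a * ζ₁) * V = n + 1 := by
    have e : (X - C ζ₁) * (X - C z) ^ n
        = (X - C z) ^ (n + 1) + (z - ζ₁) • (X - C z) ^ n := by
      rw [smul_eq_C_mul, C_sub, pow_succ]; ring
    rw [e, map_add, map_smul, smul_eq_mul, ← hb0] at h0
    rw [hb1] at hlog
    refine mul_right_cancel₀ hP0 ?_
    linear_combination -(n + 1 : ℂ) * h0 + (z - ζ₁) * hlog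
  set d : ℂ := a * z - a * ζ₁ with hd
  have hdim : d.im < (a * z).im := by rw [hd, Complex.sub_im]; linarith
  have hn : (0 : ℝ) < n + 1 := by positivity
  have hd0 : d ≠ 0 := by
    intro h
    rw [h, zero_mul] at hdV
    exact (Nat.cast_add_one_ne_zero n : (n + 1 : ℂ) ≠ 0) hdV.symm
  have hNpos : 0 < Complex.normSq d := Complex.normSq_pos.2 hd0
  have hVd : V = ((n + 1 : ℝ) : ℂ) * d⁻¹ := by
    rw [← div_eq_mul_inv, eq_div_iff hd0, mul_comm, hdV]; push_cast; rfl
  have hVim : -V.im = (n + 1) * (d.im / Complex.normSq d) := by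
    rw [hVd, Complex.im_ofReal_mul, Complex.inv_im]; ring
  have hVn : Complex.normSq V = (n + 1) * (n + 1) / Complex.normSq d := by
    rw [hVd, Complex.normSq_mul, Complex.normSq_ofReal, Complex.normSq_inv, ← div_eq_mul_inv]
  have hVim0 : 0 ≤ -V.im := by
    by_contra! hneg
    have h1 : (P.roots.card : ℝ) * (-V.im) ≤ 0 :=
      mul_nonpos_of_nonneg_of_nonpos (Nat.cast_nonneg _) hneg.le
    have h2 : 0 < (a * z).im * Complex.normSq V := by rw [hVn]; positivity
    linarith
  have hfin : (a * z).im * Complex.normSq V ≤ (n + 1) * -V.im :=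
    hVle.trans (mul_le_mul_of_nonneg_right hcard hVim0)
  rw [hVn, hVim] at hfin
  have : (n + 1) * (n + 1) / Complex.normSq d * (a * z).im
      ≤ (n + 1) * (n + 1) / Complex.normSq d * d.im := by
    calc _ = (a * z).im * ((n + 1) * (n + 1) / Complex.normSq d) := by ring
      _ ≤ _ := hfin
      _ = _ := by ring
  exact absurd (le_of_mul_le_mul_left this (by positivity)) (not_le.2 hdim)

/-- The Grace–Walsh–Szegő theorem for an open half-plane with `0` on its boundary, stated for
linear functionals. The half-plane is convex, so no assumption on the degree of
`ζ ↦ L ((X - ζ) ^ n)` is needed. -/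
theorem linearFunctional_prod_ne_zero {a : ℂ} (ha : a ≠ 0) (s : Multiset ℂ)
    (hs : ∀ ζ ∈ s, 0 < (a * ζ).im)
    (L : ℂ[X] →ₗ[ℂ] ℂ) (hL : ∀ ζ : ℂ, 0 < (a * ζ).im → L ((X - C ζ) ^ s.card) ≠ 0) :
    L (s.map (X - C ·)).prod ≠ 0 := by
  induction s using Multiset.induction generalizing L with
  | empty =>
    simpa using hL (a⁻¹ * Complex.I) (by simp [mul_inv_cancel_left₀ ha])
  | cons ζ₁ s ih =>
    rw [Multiset.map_cons, Multiset.prod_cons]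
    refine ih (fun ζ hζ => hs ζ (Multiset.mem_cons_of_mem hζ))
      (L ∘ₗ LinearMap.mulLeft ℂ (X - C ζ₁)) fun z hz => ?_
    rw [Multiset.card_cons] at hL
    exact linearFunctional_polar_ne_zero L hL (hs ζ₁ (Multiset.mem_cons_self ζ₁ s)) hz

/-! ### Diagonal operators -/

/-- The linear operator on complex polynomials with `z ^ k ↦ g k * z ^ k`. -/
noncomputable def complexDiagonalOperator (g : ℕ → ℂ) : ℂ[X] →ₗ[ℂ] ℂ[X] :=
  (Polynomial.basisMonomials ℂ).constr ℂ fun k => C (g k) * X ^ k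

theorem complexDiagonalOperator_X_pow (g : ℕ → ℂ) (k : ℕ) :
    complexDiagonalOperator g (X ^ k) = C (g k) * X ^ k := by
  have h := (Polynomial.basisMonomials ℂ).constr_basis ℂ (fun k => C (g k) * X ^ k : ℕ → ℂ[X]) k
  simpa [complexDiagonalOperator, Polynomial.X_pow_eq_monomial] using h

theorem coeff_of_forall_map_X_pow {R : Type*} [CommSemiring R] {T : R[X] →ₗ[R] R[X]} {g : ℕ → R}
    (hT : ∀ k : ℕ, T (X ^ k) = C (g k) * X ^ k) (p : R[X]) (k : ℕ) :
    (T p).coeff k = g k * p.coeff k := by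
  induction p using Polynomial.induction_on' with
  | add p q hp hq => rw [map_add, coeff_add, coeff_add, hp, hq, mul_add]
  | monomial n a =>
    rw [← C_mul_X_pow_eq_monomial, ← smul_eq_C_mul, map_smul, hT]
    simp only [coeff_smul, coeff_C_mul, coeff_X_pow, smul_eq_mul]
    split_ifs with h
    · rw [h, mul_one, mul_one, mul_comm]
    · simp

theorem coeff_complexDiagonalOperator (g : ℕ → ℂ) (p : ℂ[X]) (k : ℕ) :
    (complexDiagonalOperator g p).coeff k = g k * p.coeff k :=
  coeff_of_forall_map_X_pow (complexDiagonalOperator_X_pow g) p k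

theorem derivative_complexDiagonalOperator (g : ℕ → ℂ) (p : ℂ[X]) :
    derivative (complexDiagonalOperator g p)
      = complexDiagonalOperator (fun k => g (k + 1)) (derivative p) := by
  ext k
  simp only [coeff_derivative, coeff_complexDiagonalOperator]
  ring

theorem complexDiagonalOperator_X_pow_mul (g : ℕ → ℂ) (m : ℕ) (p : ℂ[X]) :
    complexDiagonalOperator g (X ^ m * p)
      = X ^ m * complexDiagonalOperator (fun k => g (k + m)) p := by
  ext k
  simp only [coeff_complexDiagonalOperator, coeff_X_pow_mul']
  split_ifs with h
  · rw [Nat.sub_add_cancel h]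
  · rw [mul_zero]

theorem complexDiagonalOperator_comp_C_mul_X (g : ℕ → ℂ) (u : ℂ) (p : ℂ[X]) :
    complexDiagonalOperator g (p.comp (C u * X))
      = (complexDiagonalOperator g p).comp (C u * X) := by
  ext k
  simp only [coeff_complexDiagonalOperator, comp_C_mul_X_coeff]
  ring

/-! ### Sequences with real-rooted images of `(X - 1) ^ n` -/

/-- The images of the powers `(X - 1) ^ n` under the diagonal operator of `g` have only real zeros
(or vanish identically). -/
def HasRealRootedBinomialImages (g : ℕ → ℂ) : Prop :=
  ∀ n : ℕ, ZerosIn (complexDiagonalOperator g ((X - C 1) ^ n)) {z | z.im = 0}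

theorem zerosIn_real_derivative {p : ℂ[X]} (hp : ZerosIn p {z | z.im = 0}) :
    ZerosIn (derivative p) {z | z.im = 0} := by
  intro h0 z hz
  have hdeg : 0 < p.degree := by
    by_contra! h
    exact h0 (by rw [eq_C_of_degree_le_zero h, derivative_C])
  have hp0 : p ≠ 0 := by rintro rfl; simp at h0
  have hconv : Convex ℝ {z : ℂ | z.im = 0} :=
    convex_hyperplane (IsLinearMap.mk Complex.add_im (by simp)) 0
  refine convexHull_min (fun w hw => ?_) hconv
    (rootSet_derivative_subset_convexHull_rootSet hdeg ?_)
  · rw [mem_rootSet, coe_aeval_eq_eval] at hw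
    exact hp hp0 w hw.2
  · rw [mem_rootSet, coe_aeval_eq_eval]
    exact ⟨h0, hz⟩

theorem HasRealRootedBinomialImages.shift {g : ℕ → ℂ} (hg : HasRealRootedBinomialImages g)
    (m : ℕ) : HasRealRootedBinomialImages fun k => g (k + m) := by
  induction m with
  | zero => exact hg
  | succ m ih =>
    intro n h0 z hz
    have hder := zerosIn_real_derivative (ih (n + 1))
    have hn : (n + 1 : ℂ) ≠ 0 := Nat.cast_add_one_ne_zero n
    have e : derivative (complexDiagonalOperator (fun k => g (k + m)) ((X - C 1) ^ (n + 1)))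
        = (n + 1 : ℂ) • complexDiagonalOperator (fun k => g (k + (m + 1))) ((X - C 1) ^ n) := by
      rw [derivative_complexDiagonalOperator, derivative_X_sub_C_pow, ← map_smul]
      simp only [smul_eq_C_mul, add_assoc, add_comm 1 m]
      simp
    rw [e] at hder
    refine hder (smul_ne_zero hn h0) z ?_
    rw [IsRoot.def, eval_smul, hz.eq_zero, smul_zero]

/-- All coefficients of `(X - 1) ^ n` up to degree `n` are nonzero, so a diagonal operator that
annihilates this power annihilates every polynomial of degree at most `n`. -/
theorem complexDiagonalOperator_X_sub_one_pow_ne_zero {g : ℕ → ℂ} {p : ℂ[X]} {n : ℕ}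
    (hn : p.natDegree ≤ n) (hp : complexDiagonalOperator g p ≠ 0) :
    complexDiagonalOperator g ((X - C 1) ^ n) ≠ 0 := by
  contrapose! hp
  ext k
  rw [coeff_complexDiagonalOperator, coeff_zero]
  rcases le_or_gt k n with hk | hk
  · have h := congrArg (fun q => coeff q k) hp
    simp only [coeff_complexDiagonalOperator, coeff_zero] at h
    have hne : ((X - C (1 : ℂ)) ^ n).coeff k ≠ 0 := by
      rw [sub_eq_add_neg, ← C_neg, coeff_X_add_C_pow]
      refine mul_ne_zero (pow_ne_zero _ (by norm_num)) ?_
      exact_mod_cast (Nat.choose_pos hk).ne'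
    rw [(mul_eq_zero.1 h).resolve_right hne, zero_mul]
  · rw [coeff_eq_zero_of_natDegree_lt (hn.trans_lt hk), mul_zero]

/-- If the image of `(X - 1) ^ n` is nonzero and real-rooted, the zeros of the image of `(X - ζ) ^ n` lie on
the line `ℝ ζ`. -/
theorem HasRealRootedBinomialImages.eval_X_sub_C_pow_ne_zero {g : ℕ → ℂ}
    (hg : HasRealRootedBinomialImages g) {n : ℕ}
    (hn : complexDiagonalOperator g ((X - C 1) ^ n) ≠ 0) {ζ w : ℂ} (hw : (w / ζ).im ≠ 0) :
    (complexDiagonalOperator g ((X - C ζ) ^ n)).eval w ≠ 0 := by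
  have hζ : ζ ≠ 0 := by rintro rfl; simp at hw
  have e : (X - C ζ) ^ n = C (ζ ^ n) * ((X - C 1) ^ n : ℂ[X]).comp (C ζ⁻¹ * X) := by
    rw [pow_comp, C_pow, ← mul_pow]
    simp only [sub_comp, X_comp, C_comp, mul_sub, ← mul_assoc, ← C_mul, mul_inv_cancel₀ hζ]
    simp
  rw [e, ← smul_eq_C_mul, map_smul, complexDiagonalOperator_comp_C_mul_X, eval_smul, eval_comp]
  refine smul_ne_zero (pow_ne_zero _ hζ) fun h => hw ?_
  refine hg n hn _ ?_
  rw [IsRoot.def, ← h]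
  simp [div_eq_inv_mul]

/-- If all zeros of `q` lie strictly on one side of the line `ℝ w`, then the image of `q` does not
vanish at `w`. The side is recorded by `a`, which is a real multiple of `w⁻¹`. -/
theorem HasRealRootedBinomialImages.eval_ne_zero {g : ℕ → ℂ}
    (hg : HasRealRootedBinomialImages g) {q : ℂ[X]} (hq : complexDiagonalOperator g q ≠ 0)
    {a w : ℂ} (ha : a ≠ 0) (haw : (a * w).im = 0) (hw : w ≠ 0)
    (hroots : ∀ ζ ∈ q.roots, 0 < (a * ζ).im) :
    (complexDiagonalOperator g q).eval w ≠ 0 := by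
  have hq0 : q ≠ 0 := by rintro rfl; simp at hq
  have hsplit := IsAlgClosed.splits q
  have hcard : q.roots.card = q.natDegree := hsplit.natDegree_eq_card_roots.symm
  have h := linearFunctional_prod_ne_zero ha q.roots hroots
    ((leval w) ∘ₗ complexDiagonalOperator g) fun ζ hζ => by
      refine hg.eval_X_sub_C_pow_ne_zero
        (complexDiagonalOperator_X_sub_one_pow_ne_zero hcard.ge hq) fun hreal => ?_
      -- A real ratio `w / ζ` would make `a ζ`, like `a w`, real.
      have hζ0 : ζ ≠ 0 := by rintro rfl; simp at hζ
      have e : a * w = (w / ζ).re * (a * ζ) := by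
        have : ((w / ζ).re : ℂ) = w / ζ := Complex.ext (by simp) (by simp [hreal])
        rw [this]
        field_simp
      rw [e, Complex.im_ofReal_mul, mul_eq_zero] at haw
      rcases haw with h | h
      · exact div_ne_zero hw hζ0 (Complex.ext h hreal)
      · exact hζ.ne' h
  rw [hsplit.eq_prod_roots, ← smul_eq_C_mul, map_smul, eval_smul]
  exact smul_ne_zero (leadingCoeff_ne_zero.2 hq0) h

/-! ### Sectors -/

theorem mem_sector_iff {θ : ℝ} (hθ₀ : 0 < θ) (hθ₁ : θ < Real.pi / 2) (z : ℂ) :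
    z ∈ sector θ ↔ |z.im| * Real.cos θ ≤ z.re * Real.sin θ := by
  rcases eq_or_ne z 0 with rfl | hz
  · simp [sector]
  have hr : 0 < ‖z‖ := norm_pos_iff.2 hz
  have hlt := Complex.abs_arg_le_pi z
  have him : |z.im| = ‖z‖ * Real.sin |z.arg| := by
    rw [← Complex.norm_mul_sin_arg z, abs_mul, abs_norm, Real.abs_sin_eq_sin_abs_of_abs_le_pi hlt]
  have hre : z.re = ‖z‖ * Real.cos |z.arg| := by
    rw [Real.cos_abs, Complex.norm_mul_cos_arg]
  have key : |z.im| * Real.cos θ - z.re * Real.sin θ = ‖z‖ * Real.sin (|z.arg| - θ) := by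
    rw [him, hre, Real.sin_sub]; ring
  have h0 := abs_nonneg z.arg
  simp only [sector, Set.mem_ofPred_eq, hz, or_false]
  rw [← sub_nonpos (b := z.re * Real.sin θ), key]
  constructor
  · intro h
    exact mul_nonpos_of_nonneg_of_nonpos hr.le
      (Real.sin_nonpos_of_nonpos_of_neg_pi_le (by linarith) (by linarith))
  · intro h
    by_contra! hgt
    exact absurd h (not_le.2 (mul_pos hr (Real.sin_pos_of_pos_of_lt_pi (by linarith) (by linarith))))

theorem mem_doubleSector_iff {θ : ℝ} (hθ₀ : 0 < θ) (hθ₁ : θ < Real.pi / 2) (z : ℂ) :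
    z ∈ doubleSector θ ↔ |z.im| * Real.cos θ ≤ |z.re| * Real.sin θ := by
  have hs : 0 < Real.sin θ := Real.sin_pos_of_pos_of_lt_pi hθ₀ (by linarith)
  simp only [doubleSector, Set.mem_ofPred_eq, mem_sector_iff hθ₀ hθ₁, Complex.neg_im, abs_neg,
    Complex.neg_re]
  rcases le_total 0 z.re with h | h
  · rw [abs_of_nonneg h]
    refine ⟨fun h' => h'.elim id fun h'' => h''.trans ?_, Or.inl⟩
    exact mul_le_mul_of_nonneg_right (by linarith) hs.le
  · rw [abs_of_nonpos h]
    refine ⟨fun h' => h'.elim (fun h'' => h''.trans ?_) id, Or.inr⟩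
    exact mul_le_mul_of_nonneg_right (by linarith) hs.le

/-- A point `w` outside the double sector spans a line which has the nonzero points of the sector
strictly on one side. -/
theorem exists_halfPlane_of_notMem_doubleSector {θ : ℝ} (hθ₀ : 0 < θ) (hθ₁ : θ < Real.pi / 2)
    {w : ℂ} (hw : w ∉ doubleSector θ) :
    ∃ a : ℂ, a ≠ 0 ∧ (a * w).im = 0 ∧ ∀ ζ ∈ sector θ, ζ ≠ 0 → 0 < (a * ζ).im := by
  have hs : 0 < Real.sin θ := Real.sin_pos_of_pos_of_lt_pi hθ₀ (by linarith)
  have hc : 0 < Real.cos θ := Real.cos_pos_of_mem_Ioo ⟨by linarith, hθ₁⟩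
  rw [mem_doubleSector_iff hθ₀ hθ₁, not_le] at hw
  have key : ∀ ζ ∈ sector θ, ζ ≠ 0 → |w.re * ζ.im| < |w.im| * ζ.re := by
    intro ζ hζ hζ0
    rw [mem_sector_iff hθ₀ hθ₁] at hζ
    have hre0 : 0 ≤ ζ.re := by
      by_contra! h
      have h1 := mul_neg_of_neg_of_pos h hs
      have h2 : 0 ≤ |ζ.im| * Real.cos θ := by positivity
      linarith
    have hre : 0 < ζ.re := by
      refine hre0.lt_of_ne' fun h => hζ0 (Complex.ext h ?_)
      rw [h, zero_mul] at hζ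
      have : |ζ.im| ≤ 0 := nonpos_of_mul_nonpos_left hζ hc
      simpa using this
    rw [abs_mul]
    refine lt_of_mul_lt_mul_right ?_ hc.le
    calc |w.re| * |ζ.im| * Real.cos θ = |w.re| * (|ζ.im| * Real.cos θ) := by ring
      _ ≤ |w.re| * (ζ.re * Real.sin θ) := by gcongr
      _ = |w.re| * Real.sin θ * ζ.re := by ring
      _ < |w.im| * Real.cos θ * ζ.re := by gcongr
      _ = |w.im| * ζ.re * Real.cos θ := by ring
  have hw0 : w.im ≠ 0 := by
    intro h
    rw [h, abs_zero, zero_mul] at hw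
    have : 0 ≤ |w.re| * Real.sin θ := by positivity
    linarith
  have hwne : w ≠ 0 := by rintro rfl; simp at hw0
  have hconj : (starRingEnd ℂ) w ≠ 0 := by simpa using hwne
  rcases lt_or_gt_of_ne hw0 with h | h
  · refine ⟨(starRingEnd ℂ) w, hconj, by simp; ring, fun ζ hζ hζ0 => ?_⟩
    have h1 := key ζ hζ hζ0
    rw [abs_of_neg h] at h1
    have h2 := neg_abs_le (w.re * ζ.im)
    simp only [Complex.mul_im, Complex.conj_re, Complex.conj_im]
    linarith
  · refine ⟨-(starRingEnd ℂ) w, neg_ne_zero.2 hconj, by simp; ring, fun ζ hζ hζ0 => ?_⟩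
    have h1 := key ζ hζ hζ0
    rw [abs_of_pos h] at h1
    have h2 := le_abs_self (w.re * ζ.im)
    simp only [Complex.mul_im, Complex.conj_re, Complex.conj_im, Complex.neg_re, Complex.neg_im]
    linarith

theorem neg_mem_doubleSector {θ : ℝ} {z : ℂ} : -z ∈ doubleSector θ ↔ z ∈ doubleSector θ := by
  simp [doubleSector, or_comm]

theorem norm_mul_exp_notMem_doubleSector {θ : ℝ} (hθ₀ : 0 < θ) (hθ₁ : θ < Real.pi / 2) {r ψ : ℝ}
    (hr : 0 < r) (h₁ : θ < |ψ|) (h₂ : |ψ| ≤ Real.pi / 2) :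
    (r : ℂ) * Complex.exp (ψ * Complex.I) ∉ doubleSector θ := by
  rw [mem_doubleSector_iff hθ₀ hθ₁, not_le, Complex.re_ofReal_mul, Complex.im_ofReal_mul,
    Complex.exp_ofReal_mul_I_re, Complex.exp_ofReal_mul_I_im, abs_mul, abs_mul, abs_of_pos hr,
    Real.abs_sin_eq_sin_abs_of_abs_le_pi (by linarith [Real.pi_pos]), ← Real.cos_abs ψ,
    abs_of_nonneg (Real.cos_nonneg_of_neg_pi_div_two_le_of_le (by linarith [abs_nonneg ψ]) h₂)]
  have h := mul_pos hr (Real.sin_pos_of_pos_of_lt_pi (x := |ψ| - θ) (by linarith)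
    (by linarith [Real.pi_pos]))
  rw [Real.sin_sub] at h
  linarith

/-- A nonreal point can be moved out of the double sector by a rotation through an angle of absolute
value at most `θ`. -/
theorem exists_rotation_notMem_doubleSector {θ : ℝ} (hθ₀ : 0 < θ) (hθ₁ : θ < Real.pi / 2)
    {w : ℂ} (hw : w.im ≠ 0) :
    ∃ α : ℝ, |α| ≤ θ ∧ Complex.exp (α * Complex.I) * w ∉ doubleSector θ := by
  -- Rotate past the nearer boundary ray by the angle `ε`, without passing the imaginary axis.
  have key : ∀ v : ℂ, v.im ≠ 0 → v ∈ sector θ →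
      ∃ α : ℝ, |α| ≤ θ ∧ Complex.exp (α * Complex.I) * v ∉ doubleSector θ := by
    intro v hv hmem
    have hv0 : v ≠ 0 := by rintro rfl; simp at hv
    have harg : |v.arg| ≤ θ := hmem.resolve_right hv0
    have harg0 : v.arg ≠ 0 := fun h => hv (Complex.arg_eq_zero_iff.1 h).2
    have hrot : ∀ α : ℝ, Complex.exp (α * Complex.I) * v
        = (‖v‖ : ℂ) * Complex.exp ((α + v.arg : ℝ) * Complex.I) := by
      intro α
      conv_lhs => rw [← Complex.norm_mul_exp_arg_mul_I v]
      rw [Complex.ofReal_add, add_mul, Complex.exp_add]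
      ring
    have hr : 0 < ‖v‖ := norm_pos_iff.2 hv0
    obtain ⟨h1, h2⟩ := abs_le.1 harg
    set ε := min |v.arg| (Real.pi / 2 - θ) with hε
    have hεpos : 0 < ε := lt_min (abs_pos.2 harg0) (by linarith)
    have hε1 : ε ≤ |v.arg| := min_le_left _ _
    have hε2 : ε ≤ Real.pi / 2 - θ := min_le_right _ _
    rcases lt_or_gt_of_ne harg0 with h | h
    · rw [abs_of_neg h] at hε1
      refine ⟨-(θ + ε) - v.arg, abs_le.2 ⟨by linarith, by linarith⟩, ?_⟩
      rw [hrot, sub_add_cancel]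
      refine norm_mul_exp_notMem_doubleSector hθ₀ hθ₁ hr ?_ ?_ <;>
        rw [abs_neg, abs_of_pos (by linarith)] <;> linarith
    · rw [abs_of_pos h] at hε1
      refine ⟨(θ + ε) - v.arg, abs_le.2 ⟨by linarith, by linarith⟩, ?_⟩
      rw [hrot, sub_add_cancel]
      refine norm_mul_exp_notMem_doubleSector hθ₀ hθ₁ hr ?_ ?_ <;>
        rw [abs_of_pos (by linarith)] <;> linarith
  by_cases hmem : w ∈ doubleSector θ
  · rcases hmem with h | h
    · exact key w hw h
    · obtain ⟨α, hα, hout⟩ := key (-w) (by simpa using hw) h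
      exact ⟨α, hα, by rwa [mul_neg, neg_mem_doubleSector] at hout⟩
  · exact ⟨0, by simpa using hθ₀.le, by simpa using hmem⟩

/-! ### The two implications -/

theorem HasRealRootedBinomialImages.zerosIn_doubleSector {g : ℕ → ℂ}
    (hg : HasRealRootedBinomialImages g) {θ : ℝ} (hθ₀ : 0 < θ) (hθ₁ : θ < Real.pi / 2) {p : ℂ[X]}
    (hp : ZerosIn p (sector θ)) : ZerosIn (complexDiagonalOperator g p) (doubleSector θ) := by
  intro h0 w hroot
  by_contra hw
  have hp0 : p ≠ 0 := by rintro rfl; simp at h0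
  have hw0 : w ≠ 0 := by rintro rfl; exact hw (Or.inl (Or.inr rfl))
  obtain ⟨q, hq, hdvd⟩ := exists_eq_pow_rootMultiplicity_mul_and_not_dvd p hp0 0
  rw [C_0, sub_zero] at hq hdvd
  set m := p.rootMultiplicity 0
  have hq0 : q ≠ 0 := by rintro rfl; simp at hdvd
  obtain ⟨a, ha, haw, hside⟩ := exists_halfPlane_of_notMem_doubleSector hθ₀ hθ₁ hw
  rw [hq, complexDiagonalOperator_X_pow_mul] at h0 hroot
  refine (hg.shift m).eval_ne_zero (right_ne_zero_of_mul h0) ha haw hw0 (fun ζ hζ => ?_) ?_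
  · rw [mem_roots hq0] at hζ
    refine hside ζ (hp hp0 ζ ?_) ?_
    · rw [hq]
      exact root_mul_left_of_isRoot _ hζ
    · rintro rfl
      exact hdvd (by simpa using dvd_iff_isRoot.2 hζ)
  · rw [IsRoot.def, eval_mul, eval_pow, eval_X] at hroot
    exact (mul_eq_zero.1 hroot).resolve_left (pow_ne_zero _ hw0)

theorem complexDiagonalOperator_map (c : ℂ) (γ : ℕ → ℝ) (p : ℝ[X]) :
    complexDiagonalOperator (fun k => c * γ k) (p.map (algebraMap ℝ ℂ))
      = C c * (diagonalOperator γ p).map (algebraMap ℝ ℂ) := by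
  ext k
  rw [coeff_complexDiagonalOperator, coeff_C_mul, coeff_map, coeff_map,
    coeff_of_forall_map_X_pow (diagonalOperator_X_pow γ), map_mul]
  simp [mul_assoc]

theorem IsMultiplierSequenceSecondKind.hasRealRootedBinomialImages {γ : ℕ → ℝ}
    (hγ : IsMultiplierSequenceSecondKind γ) (c : ℂ) :
    HasRealRootedBinomialImages fun k => c * γ k := by
  intro n h0 z hz
  have e : ((X - C 1) ^ n : ℂ[X]) = ((X - C 1) ^ n : ℝ[X]).map (algebraMap ℝ ℂ) := by simp
  rw [e, complexDiagonalOperator_map] at h0 hz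
  refine hγ ((X - C 1) ^ n) (fun _ w hw => ?_) (right_ne_zero_of_mul h0) z ?_
  · rw [← e, IsRoot.def, eval_pow] at hw
    have h1 : w = 1 := by simpa [sub_eq_zero] using eq_zero_of_pow_eq_zero hw
    simp [h1]
  · rw [IsRoot.def, eval_C_mul] at hz
    exact (mul_eq_zero.1 hz).resolve_left fun hc => left_ne_zero_of_mul h0 (by rw [hc, C_0])

theorem isMultiplierSequenceSecondKind_of_zerosIn_doubleSector {c : ℂ} (hc : c ≠ 0) {γ : ℕ → ℝ}
    {θ : ℝ} (hθ₀ : 0 < θ) (hθ₁ : θ < Real.pi / 2)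
    (h : ∀ p : ℂ[X], ZerosIn p (sector θ) →
      ZerosIn (complexDiagonalOperator (fun k => c * γ k) p) (doubleSector θ)) :
    IsMultiplierSequenceSecondKind γ := by
  intro p hp h0 w hw
  by_contra him
  obtain ⟨α, hα, hout⟩ := exists_rotation_notMem_doubleSector hθ₀ hθ₁ him
  set u := Complex.exp (α * Complex.I) with hu
  have hu0 : u ≠ 0 := Complex.exp_ne_zero _
  have hpi := Real.pi_pos
  obtain ⟨hα1, hα2⟩ := abs_le.1 hα
  set P := p.map (algebraMap ℝ ℂ) with hP
  have hP0 : P ≠ 0 := by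
    intro hP0
    rw [hP, Polynomial.map_eq_zero] at hP0
    simp [hP0] at h0
  have hrot : ZerosIn (P.comp (C u⁻¹ * X)) (sector θ) := by
    intro _ z hz
    rw [IsRoot.def, eval_comp, eval_C_mul, eval_X] at hz
    obtain ⟨hzim, hzre⟩ := hp hP0 _ hz
    -- `z` is the rotation of a positive number by the angle `α`.
    have ez : z = ((u⁻¹ * z).re : ℂ) * u := by
      have : ((u⁻¹ * z).re : ℂ) = u⁻¹ * z := Complex.ext (by simp) (by simpa using hzim.symm)
      rw [this]
      field_simp
    left
    rw [ez, hu, Complex.arg_real_mul _ hzre, Complex.arg_exp_mul_I,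
      (toIocMod_eq_self _).2 ⟨by linarith, by linarith⟩]
    exact hα
  have hT := h _ hrot
  rw [complexDiagonalOperator_comp_C_mul_X, hP, complexDiagonalOperator_map] at hT
  refine hout (hT ?_ (u * w) ?_)
  · intro hzero
    rw [← zero_comp (p := C u⁻¹ * X)] at hzero
    have h1 := congrArg (fun q : ℂ[X] => q.comp (C u * X)) hzero
    simp only [comp_assoc, mul_comp, C_comp, X_comp, ← mul_assoc, ← C_mul, inv_mul_cancel₀ hu0,
      C_1, one_mul, comp_X, zero_comp] at h1
    exact h0 ((mul_eq_zero.1 h1).resolve_left (C_ne_zero.2 hc))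
  · rw [IsRoot.def, eval_comp, eval_C_mul, eval_C_mul, eval_X, inv_mul_cancel_left₀ hu0, hw.eq_zero,
      mul_zero]

theorem mainTheorem6 (T : ℂ[X] →ₗ[ℂ] ℂ[X]) (c : ℂ) (hc : c ≠ 0) (γ : ℕ → ℝ)
    (hT : ∀ k : ℕ, T (X ^ k) = C (c * (γ k : ℂ)) * X ^ k)
    (θ : ℝ) (hθ₀ : 0 < θ) (hθ₁ : θ < Real.pi / 2) :
    (∀ p : ℂ[X], ZerosIn p (sector θ) → ZerosIn (T p) (doubleSector θ)) ↔
      IsMultiplierSequenceSecondKind γ := by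
  have hTD : T = complexDiagonalOperator fun k => c * γ k := by
    refine LinearMap.ext fun p => Polynomial.ext fun k => ?_
    rw [coeff_of_forall_map_X_pow hT, coeff_complexDiagonalOperator]
  rw [hTD]
  exact ⟨isMultiplierSequenceSecondKind_of_zerosIn_doubleSector hc hθ₀ hθ₁,
    fun hγ _ hp => (hγ.hasRealRootedBinomialImages c).zerosIn_doubleSector hθ₀ hθ₁ hp⟩
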